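/- There exists (in ZFC, i.e. without additional set-theoretic assumptions) a set $X\subseteq[0,1]$ such that $X$ (with the subspace topology) is not Polish, but its hyperspace $K(X)$, the space of all nonempty compact subsets of $X$ with the Vietoris topology, is hereditarily Baire, i.e. every closed subspace of $K(X)$ is a Baire space. Moreover, $X$ can be chosen so that its complement $[0,1]\setminus X$ is a Menger space that is not $\sigma$-compact. Here a topological space $Y$ is Menger if for every sequence $(\mathcal U_n)_{n\in\mathbb N}$ of open covers of $Y$ there are finite subfamilies $\mathcal V_n\subseteq\mathcal U_n$ such that $\bigcup_{n}\mathcal V_n$ covers $Y$. -/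

import Mathlib

/-- A topological space is hereditarily Baire if each of its closed subspaces is a Baire space. -/
def HereditarilyBaire (Y : Type*) [TopologicalSpace Y] : Prop :=
  ∀ C : Set Y, IsClosed C → BaireSpace C

/-- A topological space is Menger if for every sequence of open covers one can choose a finite
subfamily of each of them so that all the chosen sets together cover the space. -/
def IsMengerSpace (Y : Type*) [TopologicalSpace Y] : Prop :=
  ∀ U : ℕ → Set (Set Y), (∀ n, (∀ u ∈ U n, IsOpen u) ∧ ⋃₀ (U n) = Set.univ) →
    ∃ V : ℕ → Set (Set Y), (∀ n, V n ⊆ U n ∧ (V n).Finite) ∧ ⋃₀ (⋃ n, V n) = Set.univ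

/-- The hyperspace `K(Y)` of all nonempty compact subsets of `Y`; Mathlib equips it with the
Vietoris topology, `TopologicalSpace.NonemptyCompacts.topology`. -/
abbrev Hyperspace (Y : Type*) [TopologicalSpace Y] : Type _ :=
  TopologicalSpace.NonemptyCompacts Y

/-- The hyperspace `K(Y)`, with the Vietoris topology, is hereditarily Baire. -/
def HyperspaceHereditarilyBaire (Y : Type*) [TopologicalSpace Y] : Prop :=
  HereditarilyBaire (Hyperspace Y)

open Set Filter Topology Metric Cardinal TopologicalSpace

/-! The complement of `X` is a σ-compact set together with a non-Borel set concentrated on it. Off a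
suitable σ-compact set, `[0,1]` maps onto `ℕ → ℕ` so that compact sets have bounded images
(`exists_map_onto_nat_fun`). Let 𝔡 be the cofinality of `ℕ → ℕ`. Lifting at least 𝔡 functions, fewer
than 𝔡 of them below any given one (`exists_isCofinal_mk_lt`), gives an uncountable set meeting each
compact set off the σ-compact part in fewer than 𝔡 points. Concentration makes the complement
Menger, and since 𝔡 ≤ 𝔠 the lifted set contains no Cantor set, so it is not Borel. Hence `X` is not
Polish and its complement is not σ-compact. That `K(X)` is hereditarily Baire comes from the Menger
game: by Hurewicz's theorem a strategy that shrinks balls into dense open sets can be beaten, and a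
winning reply forces the limit compact set to avoid the complement of `X`. -/

/-! ### The Menger game -/

/-- The cells answered by a finite sequence of moves, the last move being the head of the list. -/
def coveredBy {Y : Type*} (U : List ℕ → ℕ → Set Y) : List ℕ → Set Y
  | [] => ∅
  | a :: l => U l a ∪ coveredBy U l

/-- The first `n` values of `f`, the latest one at the head. -/
def history (f : ℕ → ℕ) : ℕ → List ℕ
  | 0 => []
  | n + 1 => f n :: history f n

theorem length_history (f : ℕ → ℕ) (n : ℕ) : (history f n).length = n := by
  induction n with
  | zero => rfl
  | succ n ih => simp [history, ih]

theorem finite_lists_lt (n k : ℕ) : {l : List ℕ | l.length = n ∧ ∀ a ∈ l, a < k}.Finite := by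
  have h := (List.finite_length_eq (Fin k) n).image (List.map Fin.val)
  refine h.subset ?_
  rintro l ⟨hl, hk⟩
  refine ⟨l.pmap (fun a h => ⟨a, h⟩) hk, by simpa using hl, ?_⟩
  simp [List.map_pmap]

/-- One neighbourhood serves infinitely many lists: either the tail already has a large entry, and
induction applies, or it is one of finitely many tails with small entries, and the head is large
enough for all of them. -/
theorem exists_nhds_subset_coveredBy {Y : Type*} [TopologicalSpace Y]
    (U : List ℕ → ℕ → Set Y) (hopen : ∀ l k, IsOpen (U l k)) (hmono : ∀ l, Monotone (U l))
    (hcov : ∀ l y, ∃ k, y ∈ U l k) (n : ℕ) (y : Y) :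
    ∃ k, ∃ W ∈ 𝓝 y, ∀ l : List ℕ, l.length = n → (∃ a ∈ l, k ≤ a) → W ⊆ coveredBy U l := by
  induction n with
  | zero =>
    refine ⟨0, univ, univ_mem, fun l hl ⟨a, ha, _⟩ => ?_⟩
    simp [List.length_eq_zero_iff.1 hl] at ha
  | succ n ih =>
    obtain ⟨k, W, hW, h⟩ := ih
    choose m hm using fun l => hcov l y
    have hfin := finite_lists_lt n k
    obtain ⟨b, hb⟩ := (hfin.image m).bddAbove
    refine ⟨max k b, W ∩ ⋂ l ∈ {l : List ℕ | l.length = n ∧ ∀ a ∈ l, a < k}, U l (m l),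
      inter_mem hW ((biInter_mem hfin).2 fun l _ => (hopen l _).mem_nhds (hm l)), ?_⟩
    rintro (_ | ⟨a, l⟩) hl ⟨c, hc, hkc⟩
    · simp at hc
    have hl' : l.length = n := by simpa using hl
    by_cases hs : ∃ a ∈ l, k ≤ a
    · exact fun z hz => Or.inr (h l hl' hs hz.1)
    push Not at hs
    have hmem : l ∈ {l : List ℕ | l.length = n ∧ ∀ a ∈ l, a < k} := ⟨hl', hs⟩
    have hca : c = a := by
      rcases List.mem_cons.1 hc with h | h
      · exact h
      · exact absurd (hs c h) (by simp at hkc; omega)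
    subst hca
    intro z hz
    refine Or.inl (hmono l ((hb (mem_image_of_mem m hmem)).trans ((le_max_right _ _).trans hkc)) ?_)
    exact mem_iInter₂.1 hz.2 l hmem

/-- **Hurewicz**: in the Menger game on a Menger space, with the first player restricted to
increasing covers, no strategy of the first player is winning. -/
theorem IsMengerSpace.exists_history_cover {Y : Type*} [TopologicalSpace Y] (hY : IsMengerSpace Y)
    (U : List ℕ → ℕ → Set Y) (hopen : ∀ l k, IsOpen (U l k)) (hmono : ∀ l, Monotone (U l))
    (hcov : ∀ l y, ∃ k, y ∈ U l k) : ∃ f : ℕ → ℕ, ∀ y, ∃ n, y ∈ U (history f n) (f n) := by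
  let O : ℕ → ℕ → Set Y := fun n k =>
    interior {y | ∀ l : List ℕ, l.length = n → (∃ a ∈ l, k ≤ a) → y ∈ coveredBy U l}
  have hO : ∀ n, Monotone (O n) := fun n j k hjk => interior_mono fun y hy l hl ⟨a, ha, hka⟩ =>
    hy l hl ⟨a, ha, hjk.trans hka⟩
  -- The shift skips length 0, where the condition defining `O` is vacuous and `coveredBy` is empty.
  obtain ⟨V, hV, hVcov⟩ := hY (fun n => range (O (n + 1))) fun n => by
    refine ⟨by rintro _ ⟨k, rfl⟩; exact isOpen_interior, eq_univ_of_forall fun y => ?_⟩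
    obtain ⟨k, W, hW, h⟩ := exists_nhds_subset_coveredBy U hopen hmono hcov (n + 1) y
    refine ⟨_, ⟨k, rfl⟩, mem_interior_iff_mem_nhds.2 (mem_of_superset hW ?_)⟩
    exact fun z hz l hl hk => h l hl hk hz
  have hb : ∀ n, ∃ b, ∀ v ∈ V n, v ⊆ O (n + 1) b := fun n => by
    have hg : ∀ v, ∃ k, v ∈ V n → O (n + 1) k = v := fun v => by
      by_cases hv : v ∈ V n
      · exact ((hV n).1 hv).imp fun k hk _ => hk
      · exact ⟨0, fun h => (hv h).elim⟩
    choose g hg using hg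
    obtain ⟨b, hb⟩ := ((hV n).2.image g).bddAbove
    exact ⟨b, fun v hv => (hg v hv).symm.subset.trans (hO _ (hb (mem_image_of_mem g hv)))⟩
  choose b hb using hb
  refine ⟨b, fun y => ?_⟩
  obtain ⟨v, hv, hyv⟩ : y ∈ ⋃₀ ⋃ n, V n := hVcov ▸ mem_univ y
  obtain ⟨n, hvn⟩ := mem_iUnion.1 hv
  have hy := interior_subset (hb n v hvn hyv)
  have hc : y ∈ coveredBy U (history (b) (n + 1)) :=
    hy _ (length_history _ _) ⟨b n, by simp [history], le_rfl⟩
  generalize n + 1 = m at hc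
  induction m with
  | zero => exact hc.elim
  | succ m ih => exact hc.elim (fun h => ⟨m, h⟩) ih

/-! ### Baire hyperspaces from Menger complements -/

/-- A metric space isometric to a subset `S` of a complete metric space is Baire as soon as each
point of the closure of `S` that is not in `S` is kept away by a point of a Menger space. -/
theorem baireSpace_of_isMengerSpace {M E Y : Type*} [MetricSpace M] [MetricSpace E]
    [CompleteSpace E] [TopologicalSpace Y] (hY : IsMengerSpace Y) {j : M → E} (hj : Isometry j)
    (U : M → ℕ → Set Y) (hopen : ∀ c k, IsOpen (U c k)) (hmono : ∀ c, Monotone (U c))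
    (hcov : ∀ c y, ∃ k, y ∈ U c k)
    (hlim : ∀ K ∈ closure (range j), (∀ y, ∃ c k, y ∈ U c k ∧ dist (j c) K < 1 / ((k : ℝ) + 1)) →
      K ∈ range j) : BaireSpace M := by
  refine ⟨fun D hDo hDd => Metric.dense_iff.2 fun x ε hε => ?_⟩
  -- The bound by 1/(k+1) keeps every later centre, hence the limit, that close to the centre of
  -- `p`, as `hlim` demands after the reply `k`.
  have hstep : ∀ (p : M × {r : ℝ // 0 < r}) (n k : ℕ), ∃ q : M × {r : ℝ // 0 < r},
      (q.2 : ℝ) ≤ 1 / ((n : ℝ) + 1) ∧ dist q.1 p.1 + q.2 < p.2 ∧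
      dist q.1 p.1 + q.2 < 1 / ((k : ℝ) + 1) ∧ closedBall q.1 q.2 ⊆ D n := by
    rintro ⟨c, r, hr⟩ n k
    have hk : (0 : ℝ) < 1 / ((k : ℝ) + 1) := Nat.one_div_pos_of_nat
    obtain ⟨c', hc', hcD⟩ := Metric.dense_iff.1 (hDd n) c _ (lt_min hr hk)
    obtain ⟨δ, hδ, hδD⟩ := Metric.nhds_basis_closedBall.mem_iff.1 ((hDo n).mem_nhds hcD)
    have hs : 0 < (min r (1 / ((k : ℝ) + 1)) - dist c' c) / 2 := by
      have := mem_ball.1 hc'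
      linarith
    have hn : (0 : ℝ) < 1 / ((n : ℝ) + 1) := Nat.one_div_pos_of_nat
    have h1 := min_le_left r (1 / ((k : ℝ) + 1))
    have h2 := min_le_right r (1 / ((k : ℝ) + 1))
    have h3 := min_le_left ((min r (1 / ((k : ℝ) + 1)) - dist c' c) / 2)
      (min δ (1 / ((n : ℝ) + 1)))
    refine ⟨⟨c', min ((min r (1 / ((k : ℝ) + 1)) - dist c' c) / 2) (min δ (1 / ((n : ℝ) + 1))),
      lt_min hs (lt_min hδ hn)⟩, (min_le_right _ _).trans (min_le_right _ _), ?_, ?_,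
      (closedBall_subset_closedBall ((min_le_right _ _).trans (min_le_left _ _))).trans hδD⟩
    · dsimp only
      linarith
    · dsimp only
      linarith
  choose next h1 h2 h3 h4 using hstep
  let p : List ℕ → M × {r : ℝ // 0 < r} := fun l =>
    List.rec ⟨x, ε, hε⟩ (fun a l q => next q l.length a) l
  obtain ⟨F, hF⟩ := hY.exists_history_cover (fun l => U (p l).1) (fun l k => hopen _ k)
    (fun l => hmono _) (fun l y => hcov _ y)
  let q : ℕ → M × {r : ℝ // 0 < r} := fun n => p (history F n)
  have hq : ∀ n, q (n + 1) = next (q n) n (F n) := fun n => by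
    change next (p (history F n)) (history F n).length (F n) = _
    rw [length_history]
  have hnest : ∀ n m, n ≤ m → dist (q m).1 (q n).1 + (q m).2 ≤ (q n).2 := by
    intro n m hnm
    induction m, hnm using Nat.le_induction with
    | base => simp
    | succ m hm ih =>
      have := h2 (q m) m (F m)
      rw [← hq] at this
      have := dist_triangle (q (m + 1)).1 (q m).1 (q n).1
      linarith
  have hsmall : ∀ n, ((q (n + 1)).2 : ℝ) ≤ 1 / ((n : ℝ) + 1) := fun n => hq n ▸ h1 _ _ _
  have hdist : ∀ n m, n ≤ m → dist (q m).1 (q n).1 ≤ (q n).2 := fun n m hnm => by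
    have := hnest n m hnm
    have := (q m).2.2
    linarith
  have hcauchy : CauchySeq fun n => j (q n).1 := by
    refine Metric.cauchySeq_iff'.2 fun δ hδ => ?_
    obtain ⟨n, hn⟩ := exists_nat_one_div_lt hδ
    refine ⟨n + 1, fun m hm => ?_⟩
    rw [hj.dist_eq]
    exact (hdist _ _ hm).trans_lt ((hsmall n).trans_lt hn)
  obtain ⟨K, hK⟩ := cauchySeq_tendsto_of_complete hcauchy
  have hKdist : ∀ n, dist (j (q n).1) K ≤ (q n).2 := fun n => by
    refine le_of_tendsto (tendsto_const_nhds.dist hK) ?_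
    filter_upwards [eventually_ge_atTop n] with m hm
    rw [dist_comm, hj.dist_eq]
    exact hdist n m hm
  obtain ⟨c, rfl⟩ := hlim K (mem_closure_of_tendsto hK (Eventually.of_forall fun n => ⟨_, rfl⟩))
    fun y => by
      obtain ⟨n, hn⟩ := hF y
      refine ⟨_, _, hn, ?_⟩
      have h := h3 (q n) n (F n)
      rw [← hq] at h
      have := hKdist (n + 1)
      have := dist_triangle (j (q n).1) (j (q (n + 1)).1) K
      rw [hj.dist_eq, dist_comm (q n).1] at this
      exact this.trans_lt (by linarith)
  simp only [hj.dist_eq] at hKdist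
  refine ⟨c, ?_, mem_iInter.2 fun n => h4 (q n) n (F n) ?_⟩
  · have h := h2 (q 0) 0 (F 0)
    rw [← hq] at h
    have := hKdist 1
    have := dist_triangle c (q 1).1 (q 0).1
    rw [dist_comm c (q 0).1, dist_comm c (q 1).1] at this
    refine mem_ball.2 (?_ : dist c (q 0).1 < (q 0).2)
    rw [zero_add] at h
    linarith [dist_comm c (q 0).1]
  · rw [← hq, mem_closedBall, dist_comm]
    exact hKdist (n + 1)

theorem isometry_nonemptyCompacts_map_val {α : Type*} [MetricSpace α] (X : Set α) :
    Isometry fun K : NonemptyCompacts X => K.map Subtype.val continuous_subtype_val :=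
  fun _ _ => hausdorffEDist_image isometry_subtype_coe

/-- If the complement of `X` in a closed subset `Z` of a complete metric space is Menger, then the
hyperspace `K(X)` is hereditarily Baire. -/
theorem hyperspaceHereditarilyBaire_of_isMengerSpace {α : Type*} [MetricSpace α] [CompleteSpace α]
    {Z X : Set α} (hZ : IsClosed Z) (hXZ : X ⊆ Z) (hY : IsMengerSpace ↥(Z \ X)) :
    HyperspaceHereditarilyBaire X := by
  intro C hC
  have hι := isometry_nonemptyCompacts_map_val X
  have hpt : ∀ (c : C) (K : NonemptyCompacts α) (y : α) (δ : ℝ), y ∈ K →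
      dist (c.1.map Subtype.val continuous_subtype_val) K < δ → ∃ x ∈ c.1, dist (x : α) y < δ := by
    intro c K y δ hy hd
    rw [dist_comm] at hd
    obtain ⟨z, hz, hyz⟩ := exists_dist_lt_of_hausdorffDist_lt hy hd
      (edist_ne_top K (c.1.map Subtype.val continuous_subtype_val))
    rw [SetLike.mem_coe, ← SetLike.mem_coe, NonemptyCompacts.coe_map] at hz
    obtain ⟨x, hx, rfl⟩ := hz
    exact ⟨x, hx, dist_comm y (x : α) ▸ hyz⟩
  -- A point farther than 1/(k+1) from `c` lies in no compact set within Hausdorff distance 1/(k+1)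
  -- of `c`.
  refine baireSpace_of_isMengerSpace hY (hι.comp isometry_subtype_coe)
    (fun c k => {y | 1 / ((k : ℝ) + 1) < infDist (y : α) (Subtype.val '' (c.1 : Set X))})
    (fun c k => isOpen_lt continuous_const
      ((continuous_infDist_pt _).comp continuous_subtype_val))
    (fun c k l hkl y hy => (Nat.one_div_le_one_div (α := ℝ) hkl).trans_lt hy) ?_ ?_
  · intro c y
    have hcl := (c.1.isCompact.image continuous_subtype_val).isClosed
    have hpos := (hcl.notMem_iff_infDist_pos (c.1.nonempty.image _)).1
      (by rintro ⟨x, -, hxy⟩; exact y.2.2 (hxy ▸ x.2) : (y : α) ∉ Subtype.val '' (c.1 : Set X))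
    exact exists_nat_one_div_lt hpos
  · intro K hK hKY
    have hKZ : (K : Set α) ⊆ Z := by
      intro y hy
      refine hZ.closure_subset (Metric.mem_closure_iff.2 fun δ hδ => ?_)
      obtain ⟨_, ⟨c, rfl⟩, hc⟩ := Metric.mem_closure_iff.1 hK δ hδ
      rw [dist_comm] at hc
      obtain ⟨x, -, hx⟩ := hpt c K y δ hy hc
      exact ⟨x, hXZ x.2, dist_comm y (x : α) ▸ hx⟩
    have hKX : (K : Set α) ⊆ X := by
      intro y hy
      by_contra hyX
      obtain ⟨c, k, hck, hd⟩ := hKY ⟨y, hKZ hy, hyX⟩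
      obtain ⟨x, hx, hxy⟩ := hpt c K y _ hy hd
      rw [dist_comm] at hxy
      exact lt_asymm hck ((infDist_le_dist_of_mem (mem_image_of_mem _ hx)).trans_lt hxy)
    have himg : Subtype.val '' ((↑) ⁻¹' (K : Set α) : Set X) = K := by
      simpa [Subtype.image_preimage_coe] using hKX
    let K' : NonemptyCompacts X :=
      ⟨⟨(↑) ⁻¹' (K : Set α), Topology.IsInducing.subtypeVal.isCompact_iff.2
        (himg.symm ▸ K.isCompact)⟩, (image_nonempty.1 (himg.symm ▸ K.nonempty))⟩
    have hK' : K'.map Subtype.val continuous_subtype_val = K := NonemptyCompacts.ext himg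
    refine ⟨⟨K', ?_⟩, hK'⟩
    rw [← hC.closure_eq, hι.isUniformInducing.isInducing.closure_eq_preimage_closure_image]
    rw [mem_preimage, hK']
    rwa [range_comp, Subtype.range_coe] at hK

/-! ### The dominating number and concentrated sets -/

/-- A preorder of infinite cofinality has a cofinal subset with small bounded parts. -/
theorem exists_isCofinal_mk_lt {α : Type*} [Preorder α] (hα : ℵ₀ ≤ Order.cof α) :
    ∃ D : Set α, IsCofinal D ∧ Order.cof α ≤ #D ∧
      ∀ h : α, #{d : α | d ∈ D ∧ d ≤ h} < Order.cof α := by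
  obtain ⟨s, hs, hcard⟩ := Order.exists_cof_eq α
  let ι := (Order.cof α).ord.ToType
  have hι : #ι = Order.cof α := mk_ord_toType _
  obtain ⟨e⟩ := Cardinal.eq.1 (hι.trans hcard.symm)
  let g : ι → α := fun i => e i
  have hg : ∀ x, ∃ i, x ≤ g i := fun x => by
    obtain ⟨y, hy, hxy⟩ := hs x
    exact ⟨e.symm ⟨y, hy⟩, by simpa [g] using hxy⟩
  -- The least index whose value dominates `x` is always kept, so `D` is cofinal; a kept value below
  -- `g b` has index at most `b`.
  let D : Set α := g '' {i | ∀ j < i, ¬ g i ≤ g j}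
  have hD : IsCofinal D := fun x => by
    let i := WellFounded.min (wellFounded_lt (α := ι)) {i | x ≤ g i} (hg x)
    have hi : x ≤ g i := WellFounded.min_mem (wellFounded_lt (α := ι)) {i | x ≤ g i} (hg x)
    exact ⟨g i, ⟨i, fun j hj hij =>
      WellFounded.not_lt_min (wellFounded_lt (α := ι)) {i | x ≤ g i} (hi.trans hij) hj, rfl⟩, hi⟩
  refine ⟨D, hD, Order.cof_le hD, fun h => ?_⟩
  obtain ⟨b, hb⟩ := hg h
  have hsub : {d : α | d ∈ D ∧ d ≤ h} ⊆ g '' insert b (Iio b) := by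
    rintro _ ⟨⟨i, hi, rfl⟩, hih⟩
    refine mem_image_of_mem g ?_
    rw [Iio_insert]
    by_contra hbi
    exact hi b (not_le.1 hbi) (hih.trans hb)
  have hIio : #(Iio b) < Order.cof α := by
    have := mk_Iio_lt b (by simp [ι])
    rwa [hι] at this
  calc #{d : α | d ∈ D ∧ d ≤ h} ≤ #(g '' insert b (Iio b)) := mk_le_mk_of_subset hsub
    _ ≤ #(insert b (Iio b) : Set ι) := mk_image_le
    _ ≤ #(Iio b) + 1 := mk_insert_le
    _ < Order.cof α := add_lt_of_lt hα hIio (one_lt_aleph0.trans_le hα)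

theorem aleph0_lt_cof_nat_fun : ℵ₀ < Order.cof (ℕ → ℕ) := by
  obtain ⟨s, hs, hcard⟩ := Order.exists_cof_eq (ℕ → ℕ)
  rw [← hcard]
  by_contra hle
  have hc : s.Countable := le_aleph0_iff_set_countable.1 (not_lt.1 hle)
  obtain ⟨y, hy, -⟩ := hs 0
  obtain ⟨g, rfl⟩ := hc.exists_eq_range ⟨y, hy⟩
  obtain ⟨_, ⟨n, rfl⟩, hn⟩ := hs fun n => g n n + 1
  exact absurd (hn n) (by simp)

/-- Fewer points than the dominating number can be covered by finite selections from countably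
many countable covers. -/
theorem exists_finite_selections {Y : Type*} (S : Set Y) (φ : Y → ℕ → ℕ) {X : Set (ℕ → ℕ)}
    (hφ : MapsTo φ S X) (hX : #X < Order.cof (ℕ → ℕ)) :
    ∃ b : ℕ → ℕ, ∀ y ∈ S, ∃ n, φ y n < b n := by
  by_contra! h
  refine hX.not_ge (Order.cof_le fun b => ?_)
  obtain ⟨y, hy, hyb⟩ := h b
  exact ⟨φ y, hφ hy, hyb⟩

/-- A second countable space is Menger if it contains a σ-compact set all of whose open
neighbourhoods have a complement of size less than the dominating number. -/
theorem isMengerSpace_of_concentrated {Y : Type} [TopologicalSpace Y] [SecondCountableTopology Y]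
    (K : ℕ → Set Y) (hK : ∀ n, IsCompact (K n))
    (hconc : ∀ O : Set Y, IsOpen O → ⋃ n, K n ⊆ O → #(Oᶜ : Set Y) < Order.cof (ℕ → ℕ)) :
    IsMengerSpace Y := by
  intro U hU
  have h1 : ∀ n, ∃ V ⊆ U n, V.Finite ∧ K n ⊆ ⋃₀ V := fun n =>
    by
    obtain ⟨V, hVU, hV, hKV⟩ := (hK n).elim_finite_subcover_image (b := U n) (c := id) (hU n).1
      (by simp only [id, ← sUnion_eq_biUnion, (hU n).2, subset_univ])
    exact ⟨V, hVU, hV, by simpa only [id, ← sUnion_eq_biUnion] using hKV⟩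
  choose V hVU hVfin hKV using h1
  let O : Set Y := ⋃ n, ⋃₀ V n
  have hO : IsOpen O := isOpen_iUnion fun n => isOpen_sUnion fun v hv => (hU n).1 v (hVU n hv)
  have hsmall := hconc O hO (iUnion_mono hKV)
  have h2 : ∀ n, ∃ T : Set (Set Y), T.Countable ∧ T ⊆ U n ∧ ⋃₀ T = Set.univ := fun n => by
    obtain ⟨T, hT, hTU, hTeq⟩ := isOpen_sUnion_countable (U n) (hU n).1
    exact ⟨T, hT, hTU, hTeq.trans (hU n).2⟩
  choose T hT hTU hTcov using h2
  choose f hf using fun n => countable_iff_exists_injOn.1 (hT n)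
  have h3 : ∀ (y : Y) (n : ℕ), ∃ t ∈ T n, y ∈ t := fun y n => by
    have : y ∈ ⋃₀ T n := hTcov n ▸ mem_univ y
    exact this
  choose t ht hyt using h3
  obtain ⟨b, hb⟩ := exists_finite_selections Oᶜ (fun y n => f n (t y n))
    (mapsTo_image _ _) (mk_image_le.trans_lt hsmall)
  refine ⟨fun n => V n ∪ {u ∈ T n | f n u < b n}, fun n => ⟨union_subset (hVU n)
    ((sep_subset _ _).trans (hTU n)), (hVfin n).union ?_⟩, eq_univ_of_forall fun y => ?_⟩
  · refine Finite.of_finite_image ((finite_Iio (b n)).subset ?_) ((hf n).mono (sep_subset _ _))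
    rintro _ ⟨u, hu, rfl⟩
    exact hu.2
  · by_cases hy : y ∈ O
    · obtain ⟨n, v, hv, hyv⟩ := mem_iUnion.1 hy
      exact ⟨v, mem_iUnion.2 ⟨n, Or.inl hv⟩, hyv⟩
    · obtain ⟨n, hn⟩ := hb y hy
      exact ⟨_, mem_iUnion.2 ⟨n, Or.inr ⟨ht y n, hn⟩⟩, hyt y n⟩

/-! ### Cantor sets and the construction of `X` -/

/-- A Borel subset of a Polish space all of whose compact subsets have less than continuum many
points is countable. -/
theorem MeasurableSet.countable_of_mk_compact_lt {α : Type} [TopologicalSpace α] [PolishSpace α]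
    [MeasurableSpace α] [BorelSpace α] {A : Set α} (hA : MeasurableSet A)
    (hcpt : ∀ L ⊆ A, IsCompact L → #L < 𝔠) : A.Countable := by
  by_contra hunc
  obtain ⟨f, hfA, hfc, hfi⟩ : ∃ f : (ℕ → Bool) → α, range f ⊆ A ∧ Continuous f ∧
      Function.Injective f := by
    -- A Cantor set found in a finer Polish topology making `A` closed stays compact in the original
    -- one.
    obtain ⟨t', hle, hpol, hcl, -⟩ := hA.isClopenable
    obtain ⟨f, hfA, hfc, hfi⟩ :=
      @IsClosed.exists_nat_bool_injection_of_not_countable α t' hpol A hcl hunc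
    exact ⟨f, hfA, continuous_le_rng hle hfc, hfi⟩
  refine (hcpt _ hfA (isCompact_range hfc)).ne ?_
  rw [mk_range_eq f hfi]
  simp

/-- There is a subset of `[0, 1]` with σ-compact complement that is mapped onto the Baire space in
such a way that its compact subsets have bounded images. -/
theorem exists_map_onto_nat_fun : ∃ (C : ℕ → Set ℝ) (g : ℝ → ℕ → ℕ),
    (∀ n, IsCompact (C n)) ∧ (∀ n, C n ⊆ Icc 0 1) ∧
    (∀ h, ∃ x ∈ Icc (0 : ℝ) 1 \ ⋃ n, C n, g x = h) ∧
    ∀ L ⊆ Icc (0 : ℝ) 1 \ ⋃ n, C n, IsCompact L → ∃ h, ∀ x ∈ L, g x ≤ h := by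
  obtain ⟨c, hcI, hc, hinj⟩ :=
    (isClosed_Icc (a := (0 : ℝ)) (b := 1)).exists_nat_bool_injection_of_not_countable
      fun h => absurd ((Cardinal.mk_Icc_real zero_lt_one).symm.trans_le
        (le_aleph0_iff_set_countable.2 h)) aleph0_lt_continuum.not_ge
  obtain ⟨F, hF, -, hFc, -⟩ :=
    (isCompact_range hc).isClosed.isOpen_compl.exists_iUnion_isClosed
  -- Points of the Cantor set are read as arrays. Those with an empty row are discarded, and `g`
  -- records the first `true` in each row; on a compact set of remaining arrays these positions are
  -- bounded row by row.
  let A : ℕ → Set (ℕ → Bool) := fun n => {z | ∀ i, z (Nat.pair n i) = false}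
  have hA : ∀ n, IsCompact (A n) := fun n => IsClosed.isCompact <| by
    simp only [A, ofPred_forall]
    exact isClosed_iInter fun i => isClosed_eq (continuous_apply _) continuous_const
  let g : ℝ → ℕ → ℕ := fun x n => sInf {i | ∃ z, c z = x ∧ z (Nat.pair n i) = true}
  have hg : ∀ z n, g (c z) n = sInf {i | z (Nat.pair n i) = true} := fun z n => by
    simp [g, hinj.eq_iff]
  refine ⟨fun n => F n ∩ Icc 0 1 ∪ c '' A n, g,
    fun n => (isCompact_Icc.inter_left (hF n)).union ((hA n).image hc),
    fun n => union_subset inter_subset_right ((image_subset_range _ _).trans hcI), ?_, ?_⟩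
  · intro h
    let z : ℕ → Bool := fun m => decide (h m.unpair.1 = m.unpair.2)
    refine ⟨c z, ⟨hcI (mem_range_self z), fun hz => ?_⟩, funext fun n => ?_⟩
    · obtain ⟨n, hn | ⟨w, hw, hwz⟩⟩ := mem_iUnion.1 hz
      · have : c z ∈ (range c)ᶜ := hFc ▸ mem_iUnion.2 ⟨n, hn.1⟩
        exact this (mem_range_self z)
      · have := hinj hwz ▸ hw (h n)
        simp [z] at this
    · rw [hg]
      simp [z]
  · intro L hL hLc
    have hLr : L ⊆ range c := fun x hx => by
      by_contra hxc
      rw [← mem_compl_iff, ← hFc] at hxc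
      obtain ⟨n, hn⟩ := mem_iUnion.1 hxc
      exact (hL hx).2 (mem_iUnion.2 ⟨n, Or.inl ⟨hn, (hL hx).1⟩⟩)
    have hL' : IsCompact (c ⁻¹' L) := (hLc.isClosed.preimage hc).isCompact
    have hb : ∀ n, ∃ b, ∀ z ∈ c ⁻¹' L, ∃ i ≤ b, z (Nat.pair n i) = true := fun n => by
      obtain ⟨s, hs⟩ := hL'.elim_finite_subcover (fun i => {z : ℕ → Bool | z (Nat.pair n i) = true})
        (fun i =>
          have h : Continuous fun z : ℕ → Bool => z (Nat.pair n i) := continuous_apply _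
          (isOpen_discrete {true}).preimage h)
        (fun z hz => by
          by_contra hcon
          refine (hL hz).2 (mem_iUnion.2 ⟨n, Or.inr ⟨z, fun i => ?_, rfl⟩⟩)
          simpa using fun h => hcon (mem_iUnion.2 ⟨i, h⟩))
      refine ⟨s.sup id, fun z hz => ?_⟩
      obtain ⟨i, hi, hzi⟩ := mem_iUnion₂.1 (hs hz)
      exact ⟨i, Finset.le_sup (f := id) hi, hzi⟩
    choose b hb using hb
    refine ⟨b, fun x hx n => ?_⟩
    obtain ⟨z, rfl⟩ := hLr hx
    obtain ⟨i, hib, hi⟩ := hb n z hx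
    rw [hg]
    exact (Nat.sInf_le hi).trans hib

theorem corollary3p5 :
    ∃ X : Set ℝ, X ⊆ Set.Icc 0 1 ∧
      ¬ PolishSpace X ∧
      HyperspaceHereditarilyBaire X ∧
      IsMengerSpace ↥(Set.Icc (0 : ℝ) 1 \ X) ∧
      ¬ IsSigmaCompact (Set.Icc (0 : ℝ) 1 \ X) := by
  obtain ⟨C, g, hC, hCI, hg, hbdd⟩ := exists_map_onto_nat_fun
  choose s hsP hgs using hg
  obtain ⟨D, -, hDcard, hDsmall⟩ := exists_isCofinal_mk_lt aleph0_lt_cof_nat_fun.le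
  have hsinj : Function.Injective s := Function.LeftInverse.injective hgs
  have hsmall : ∀ L ⊆ Icc (0 : ℝ) 1 \ ⋃ n, C n, IsCompact L →
      #(s '' D ∩ L : Set ℝ) < Order.cof (ℕ → ℕ) := fun L hL hLc => by
    obtain ⟨h, hh⟩ := hbdd L hL hLc
    refine lt_of_le_of_lt ((mk_le_mk_of_subset (?_ : _ ⊆ s '' {d | d ∈ D ∧ d ≤ h})).trans
      mk_image_le) (hDsmall h)
    rintro _ ⟨⟨d, hd, rfl⟩, hdL⟩
    exact ⟨d, ⟨hd, hgs d ▸ hh _ hdL⟩, rfl⟩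
  have hDP : s '' D ⊆ Icc (0 : ℝ) 1 \ ⋃ n, C n := image_subset_iff.2 fun d _ => hsP d
  have hcof : Order.cof (ℕ → ℕ) ≤ 𝔠 := (Order.cof_le_cardinalMk _).trans (by simp)
  have hmeas : ¬ MeasurableSet (s '' D) := fun hm => by
    have hcount := hm.countable_of_mk_compact_lt fun L hL hLc => by
      rw [← inter_eq_right.2 hL]
      exact (hsmall L (hL.trans hDP) hLc).trans_le hcof
    have := le_aleph0_iff_set_countable.2 hcount
    rw [mk_image_eq hsinj] at this
    exact (aleph0_lt_cof_nat_fun.trans_le hDcard).not_ge this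
  have hCI' : ⋃ n, C n ⊆ Icc (0 : ℝ) 1 := iUnion_subset hCI
  have hCm : MeasurableSet (⋃ n, C n) := .iUnion fun n => (hC n).measurableSet
  let X : Set ℝ := (Icc 0 1 \ ⋃ n, C n) \ s '' D
  have hcompl : Icc 0 1 \ X = (⋃ n, C n) ∪ s '' D := by
    ext x
    have h1 := @hCI' x
    have h2 := @hDP x
    simp only [X, Set.mem_sdiff, mem_union] at h1 h2 ⊢
    tauto
  -- Thus if `X` or its complement were Borel, so would be `s '' D`.
  have hXD : (Icc 0 1 \ X) \ ⋃ n, C n = s '' D := by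
    rw [hcompl, union_sdiff_left, sdiff_eq_left]
    exact disjoint_left.2 fun x hx => (hDP hx).2
  have hY : IsMengerSpace ↥(Icc 0 1 \ X) := by
    have hCY : ∀ n, C n ⊆ Icc 0 1 \ X := fun n =>
      hcompl ▸ (subset_iUnion C n).trans subset_union_left
    refine isMengerSpace_of_concentrated (fun n => (↑) ⁻¹' C n)
      (fun n => Topology.IsInducing.subtypeVal.isCompact_preimage_iff
        (Subtype.range_coe.symm ▸ hCY n) |>.2 (hC n)) fun O hO hCO => ?_
    obtain ⟨O', hO', rfl⟩ := isOpen_induced_iff.1 hO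
    have hCO' : ⋃ n, C n ⊆ O' := iUnion_subset fun n x hx =>
      hCO (mem_iUnion.2 ⟨n, hx⟩ : (⟨x, hCY n hx⟩ : ↥(Icc 0 1 \ X)) ∈ _)
    -- The points missed by `O'` belong to `s '' D` and to a compact set disjoint from every `C n`.
    refine lt_of_le_of_lt ?_ (hsmall (Icc 0 1 \ O') (sdiff_subset_sdiff_right hCO')
      (isCompact_Icc.diff hO'))
    rw [← mk_image_eq Subtype.val_injective]
    refine mk_le_mk_of_subset ?_
    rintro _ ⟨y, hy, rfl⟩
    have hyY := y.2
    refine ⟨?_, y.2.1, hy⟩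
    rw [← hXD]
    exact ⟨y.2, fun h => hy (hCO' h)⟩
  refine ⟨X, sdiff_subset.trans sdiff_subset, fun hX => hmeas ?_,
    hyperspaceHereditarilyBaire_of_isMengerSpace isClosed_Icc (sdiff_subset.trans sdiff_subset) hY,
    hY, fun hσ => hmeas ?_⟩
  -- Lusin–Souslin: an injective continuous image of a Polish space is Borel.
  · have hXm : MeasurableSet X := by
      have := MeasurableSet.univ.image_of_continuousOn_injOn
        (continuous_subtype_val (p := (· ∈ X))).continuousOn Subtype.val_injective.injOn
      simpa using this
    exact hXD ▸ (measurableSet_Icc.diff hXm).diff hCm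
  · obtain ⟨K, hK, hKeq⟩ := hσ
    refine hXD ▸ MeasurableSet.diff ?_ hCm
    exact hKeq ▸ .iUnion fun n => (hK n).measurableSet
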